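/- Let $K$ be a field with algebraic closure $\overline{K}$, and let $n, r \geq 0$ be integers. A linear system of degree-$d$ hypersurfaces in $\mathbb{P}^n$ over $K$ of (projective) dimension $r$ is an $(r+1)$-dimensional $K$-linear subspace $\mathcal{L}$ of the space $K[x_0,\dots,x_n]_d$ of homogeneous polynomials of degree $d$. It is called $K$-smooth if for every nonzero $F \in \mathcal{L}$ the hypersurface $\{F = 0\} \subset \mathbb{P}^n$ is smooth at all of its $\overline{K}$-points, i.e. there is no point of $\mathbb{P}^n(\overline{K})$ at which $F$ and all partial derivatives $\partial F/\partial x_0, \dots, \partial F/\partial x_n$ vanish. (1) If $r \geq n+1$, then for every $d \geq 2$ there is no $K$-smooth linear system of degree-$d$ hypersurfaces in $\mathbb{P}^n$ of dimension $r$. (2) Suppose that $K$ is finitely generated as a field (that is, generated by finitely many elements as an extension of its prime subfield) and has characteristic $p \geq 0$. If $r \leq n$, $d \geq 1$ and $p \nmid \gcd(d, n+1)$, then there exist homogeneous polynomials $F_0, \dots, F_r \in K[x_0,\dots,x_n]$ of degree $d$ such that $\mathcal{L} = \langle F_0, \dots, F_r \rangle$ is a $K$-smooth linear system of dimension $r$.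 (For $p = 0$ the divisibility condition holds automatically.) -/

import Mathlib

namespace SmoothSystem

/-- `K` is generated, as a field, by finitely many elements (equivalently, it is finitely
generated as a field extension of its prime subfield). -/
def IsFinitelyGeneratedField (K : Type*) [Field K] : Prop :=
  ∃ s : Finset K, Subfield.closure (s : Set K) = ⊤

/-- For a homogeneous polynomial `F` over `K` and a nonzero vector `v` with coordinates in an
extension `L` of `K`: the hypersurface `{F = 0}` contains the point `[v₀ : … : vₙ]` of `ℙⁿ(L)`
and is singular there, that is, `F` and all its first partial derivatives vanish at `v`. -/
def IsSingularAt {K L : Type*} [Field K] [Field L] [Algebra K L] {n : ℕ}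
    (F : MvPolynomial (Fin (n + 1)) K) (v : Fin (n + 1) → L) : Prop :=
  MvPolynomial.aeval v F = 0 ∧ ∀ i, MvPolynomial.aeval v (MvPolynomial.pderiv i F) = 0

/-- The hypersurface `{F = 0}` in `ℙⁿ` is smooth: it is nonsingular at each of its points over the
algebraic closure of `K`, the points of `ℙⁿ` being given by their (nonzero) vectors of homogeneous
coordinates. -/
def IsSmoothHypersurface {K : Type*} [Field K] {n : ℕ}
    (F : MvPolynomial (Fin (n + 1)) K) : Prop :=
  ∀ v : Fin (n + 1) → AlgebraicClosure K, v ≠ 0 → ¬ IsSingularAt F v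

/-- `S` is a linear system of degree `d` hypersurfaces in `ℙⁿ` of projective dimension `r`:
a `K`-linear subspace of vector space dimension `r + 1` of the space of homogeneous polynomials
of degree `d` in `x₀, …, xₙ`. -/
def IsLinearSystem {K : Type*} [Field K] {n : ℕ}
    (S : Submodule K (MvPolynomial (Fin (n + 1)) K)) (d r : ℕ) : Prop :=
  S ≤ MvPolynomial.homogeneousSubmodule (Fin (n + 1)) K d ∧ Module.finrank K S = r + 1

/-- The linear system `S` is `K`-smooth: each of its `K`-members, i.e. the hypersurface cut out by
any nonzero element of `S`, is smooth. -/
def IsKSmooth {K : Type*} [Field K] {n : ℕ}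
    (S : Submodule K (MvPolynomial (Fin (n + 1)) K)) : Prop :=
  ∀ F ∈ S, F ≠ 0 → IsSmoothHypersurface F

end SmoothSystem

/-! Part (1) counts conditions: being singular at a given rational point imposes at most `n + 1`
linear conditions on forms of degree `d`. For (2), take `L/K` separable of degree `n + 1` with basis
`b`, and put `Y = ∑ b l X l`. Over the algebraic closure the conjugates `y τ` of `Y` are linear
coordinates. If `p ∤ d`, the forms `Tr (a Y ^ d)` become Fermat forms `∑ τ(a) y τ ^ d`, smooth for
`a ≠ 0`. If `p ∣ d`, then `p ∤ n + 1`; with `φ` generating a cyclic Galois group, `Tr (a Y ^ (d - 1)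
φ(Y))` becomes a Klein form, a sum of terms `y_i ^ (d - 1) y_(i+1)` around a cycle, and is again
smooth. Both families are `K`-linear in `a ∈ L`. Such `L` exist because the algebraic closure `k` of
the prime field in `K` is a number field or a finite field, and irreducible polynomials over `k`
stay irreducible over `K`. -/

open MvPolynomial in
/-- The coefficientwise trace of a polynomial. -/
noncomputable def coeffTrace (K : Type*) {L σ : Type*} [Field K] [Field L] [Algebra K L] :
    MvPolynomial σ L →ₗ[K] MvPolynomial σ K :=
  (AddMonoidAlgebra.coeffLinearEquiv K).symm.toLinearMap ∘ₗ
    Finsupp.mapRange.linearMap (Algebra.trace K L) ∘ₗ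
      (AddMonoidAlgebra.coeffLinearEquiv K).toLinearMap

/-! ### Trace forms and their gradients in conjugate coordinates -/

section Trace

variable {K L : Type*} [Field K] [Field L] [Algebra K L]

open MvPolynomial

theorem coeff_coeffTrace {σ : Type*} (P : MvPolynomial σ L) (m : σ →₀ ℕ) :
    coeff m (coeffTrace K P) = Algebra.trace K L (coeff m P) := by
  rfl

theorem coeffTrace_monomial {σ : Type*} (m : σ →₀ ℕ) (c : L) :
    coeffTrace K (monomial m c) = monomial m (Algebra.trace K L c) := by
  classical
  ext k
  rw [coeff_coeffTrace, coeff_monomial, coeff_monomial]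
  split_ifs <;> simp

theorem isHomogeneous_coeffTrace {σ : Type*} {P : MvPolynomial σ L} {d : ℕ}
    (hP : P.IsHomogeneous d) : (coeffTrace K P).IsHomogeneous d := by
  intro m hm
  refine hP fun h ↦ hm ?_
  rw [coeff_coeffTrace, h, map_zero]

theorem pderiv_coeffTrace {σ : Type*} (i : σ) (P : MvPolynomial σ L) :
    pderiv i (coeffTrace K P) = coeffTrace K (pderiv i P) := by
  induction P using MvPolynomial.induction_on' with
  | monomial m a =>
    rw [coeffTrace_monomial, pderiv_monomial, pderiv_monomial, coeffTrace_monomial,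
      mul_comm, mul_comm a, ← nsmul_eq_mul, ← nsmul_eq_mul, map_nsmul (Algebra.trace K L), map_nsmul]
  | add P Q h1 h2 => simp only [map_add, h1, h2]

/-- The linear form `∑ φ(b l) X l`. -/
noncomputable def basisForm {κ : Type*} [Fintype κ] (b : Module.Basis κ K L) (φ : L →ₐ[K] L) :
    MvPolynomial κ L :=
  ∑ l, C (φ (b l)) * X l

theorem isHomogeneous_basisForm {κ : Type*} [Fintype κ] (b : Module.Basis κ K L) (φ : L →ₐ[K] L) :
    (basisForm b φ).IsHomogeneous 1 := by
  refine MvPolynomial.IsHomogeneous.sum _ _ _ fun l _ ↦ ?_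
  simpa using (isHomogeneous_C κ (φ (b l))).mul (isHomogeneous_X L l)

theorem pderiv_basisForm {κ : Type*} [Fintype κ] (b : Module.Basis κ K L) (φ : L →ₐ[K] L)
    (i : κ) : pderiv i (basisForm b φ) = C (φ (b i)) := by
  classical
  simp [basisForm, pderiv_X, Pi.single_apply]

/-- The form `Tr (a · Y ^ e · φ(Y))` of degree `e + 1`, where `Y = ∑ (b l) X l`. -/
noncomputable def traceForm {κ : Type*} [Fintype κ] (b : Module.Basis κ K L) (φ : L →ₐ[K] L)
    (e : ℕ) : L →ₗ[K] MvPolynomial κ K :=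
  coeffTrace K ∘ₗ (LinearMap.toSpanSingleton L _
    (basisForm b (AlgHom.id K L) ^ e * basisForm b φ)).restrictScalars K

theorem traceForm_apply {κ : Type*} [Fintype κ] (b : Module.Basis κ K L) (φ : L →ₐ[K] L)
    (e : ℕ) (a : L) : traceForm b φ e a =
      coeffTrace K (C a * (basisForm b (AlgHom.id K L) ^ e * basisForm b φ)) := by
  simp [traceForm, MvPolynomial.smul_eq_C_mul]

theorem isHomogeneous_traceForm {κ : Type*} [Fintype κ] (b : Module.Basis κ K L)
    (φ : L →ₐ[K] L) (e : ℕ) (a : L) : (traceForm b φ e a).IsHomogeneous (e + 1) := by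
  rw [traceForm_apply]
  refine isHomogeneous_coeffTrace ?_
  simpa using (isHomogeneous_C κ a).mul
    (((isHomogeneous_basisForm b (AlgHom.id K L)).pow e).mul (isHomogeneous_basisForm b φ))

variable [FiniteDimensional K L] [Algebra.IsSeparable K L]
  {E : Type*} [Field E] [Algebra K E] [IsAlgClosed E]

theorem aeval_coeffTrace {σ : Type*} (v : σ → E) (P : MvPolynomial σ L) :
    aeval v (coeffTrace K P) = ∑ τ : L →ₐ[K] E, eval₂ (τ : L →+* E) v P := by
  induction P using MvPolynomial.induction_on' with
  | monomial m c =>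
    simp only [coeffTrace_monomial, aeval_monomial, trace_eq_sum_embeddings E, eval₂_monomial,
      Finset.sum_mul]
    rfl
  | add P Q h1 h2 => simp only [map_add, h1, h2, eval₂_add, Finset.sum_add_distrib]

/-- The matrix of conjugates of a basis is injective on column vectors. -/
theorem eq_zero_of_sum_embeddings_mul {κ : Type*} [Fintype κ] (b : Module.Basis κ K L) (v : κ → E)
    (h : ∀ τ : L →ₐ[K] E, ∑ l, τ (b l) * v l = 0) : v = 0 := by
  classical
  have hc : Fintype.card κ = Fintype.card (L →ₐ[K] E) := by
    rw [AlgHom.card, Module.finrank_eq_card_basis b]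
  let e := Fintype.equivOfCardEq hc
  have hdet : (Algebra.embeddingsMatrixReindex K E b e).det ≠ 0 := by
    intro h0
    have := Algebra.discr_eq_det_embeddingsMatrixReindex_pow_two K E b e
    rw [h0] at this
    simp [Algebra.discr_not_zero_of_basis K b] at this
  refine Matrix.eq_zero_of_vecMul_eq_zero hdet ?_
  ext j
  simp only [Matrix.vecMul, dotProduct, Algebra.embeddingsMatrixReindex, Pi.zero_apply]
  rw [← h (e j)]
  exact Finset.sum_congr rfl fun _ _ ↦ mul_comm _ _

omit [Algebra.IsSeparable K L] [IsAlgClosed E] in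
/-- The matrix of conjugates of a basis is injective on row vectors. -/
theorem eq_zero_of_sum_mul_embeddings {κ : Type*} [Fintype κ] (b : Module.Basis κ K L)
    (c : (L →ₐ[K] E) → E) (h : ∀ l, ∑ τ : L →ₐ[K] E, τ (b l) * c τ = 0) : c = 0 := by
  -- Dedekind's independence of embeddings.
  have hli := linearIndependent_toLinearMap K L E
  rw [Fintype.linearIndependent_iff] at hli
  refine funext (hli c ?_)
  have hsum : ∀ f : (L →ₐ[K] E) → (L →ₗ[K] E), ∀ x, (∑ τ, c τ • f τ) x = ∑ τ, c τ * f τ x := by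
    simp
  refine b.ext fun l ↦ ?_
  rw [LinearMap.zero_apply, hsum, ← h l]
  exact Finset.sum_congr rfl fun _ _ ↦ mul_comm _ _

/-- Precomposition of embeddings with an automorphism. -/
def precompEquiv (E : Type*) [Field E] [Algebra K E] (φ : L ≃ₐ[K] L) :
    (L →ₐ[K] E) ≃ (L →ₐ[K] E) where
  toFun τ := τ.comp (φ : L →ₐ[K] L)
  invFun τ := τ.comp (φ.symm : L →ₐ[K] L)
  left_inv τ := by ext; simp
  right_inv τ := by ext; simp

/-- In the coordinates `y τ = τ(Y)(v)`, singularity of a trace form at `v` reads as follows. -/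
theorem exists_of_singular_traceForm {κ : Type*} [Fintype κ] (b : Module.Basis κ K L)
    (φ : L ≃ₐ[K] L) (e : ℕ) (a : L) (v : κ → E) (hv : v ≠ 0)
    (h0 : aeval v (traceForm b (φ : L →ₐ[K] L) e a) = 0)
    (h1 : ∀ i, aeval v (pderiv i (traceForm b (φ : L →ₐ[K] L) e a)) = 0) :
    ∃ y : (L →ₐ[K] E) → E, y ≠ 0 ∧
      ∑ τ, τ a * (y τ ^ e * y (precompEquiv E φ τ)) = 0 ∧
      ∀ τ : L →ₐ[K] E, (precompEquiv E φ τ) a * (e * y (precompEquiv E φ τ) ^ (e - 1) *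
        y (precompEquiv E φ (precompEquiv E φ τ))) + τ a * y τ ^ e = 0 := by
  set y : (L →ₐ[K] E) → E := fun τ ↦ ∑ l, τ (b l) * v l with hy
  have hY : ∀ (τ : L →ₐ[K] E) (ψ : L →ₐ[K] L),
      eval₂ (τ : L →+* E) v (basisForm b ψ) = y (τ.comp ψ) := by
    intro τ ψ
    simp [basisForm, hy, eval₂_sum]
  set s := precompEquiv E φ
  have hs : ∀ τ, s τ = τ.comp (φ : L →ₐ[K] L) := fun _ ↦ rfl
  refine ⟨y, fun h ↦ hv (eq_zero_of_sum_embeddings_mul b v fun τ ↦ congrFun h τ), ?_, ?_⟩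
  · rw [traceForm_apply, aeval_coeffTrace] at h0
    simpa only [eval₂_mul, eval₂_pow, eval₂_C, hY, AlgHom.comp_id] using! h0
  -- By the chain rule `∂F/∂x_i = ∑ τ(b i) ∂F/∂y_τ`, so all `∂F/∂y_τ` vanish. The claim at `τ` is
  -- this vanishing at `s τ`.
  · suffices h : (fun τ : L →ₐ[K] E ↦ τ a * (e * y τ ^ (e - 1) * y (s τ)) +
        (s.symm τ) a * y (s.symm τ) ^ e) = 0 by
      intro τ
      simpa only [Equiv.symm_apply_apply, Pi.zero_apply] using congrFun h (s τ)
    refine eq_zero_of_sum_mul_embeddings b _ fun i ↦ ?_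
    have h := h1 i
    rw [traceForm_apply, pderiv_coeffTrace, aeval_coeffTrace] at h
    simp only [pderiv_mul, pderiv_C, pderiv_pow, pderiv_basisForm, zero_mul, zero_add, eval₂_mul,
      eval₂_add, eval₂_pow, eval₂_C, eval₂_natCast, hY, AlgHom.comp_id, AlgHom.id_apply] at h
    simp only [mul_add, Finset.sum_add_distrib] at h ⊢
    rw [← h]
    congr 1
    · refine Finset.sum_congr rfl fun τ _ ↦ ?_
      rw [hs, RingHom.coe_coe]
      ring
    · rw [← Equiv.sum_comp s]
      refine Finset.sum_congr rfl fun τ _ ↦ ?_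
      rw [Equiv.symm_apply_apply, hs, RingHom.coe_coe, AlgHom.comp_apply]
      ring

end Trace

/-! ### Smoothness of Fermat and Klein forms -/

section Smooth

variable {K L : Type*} [Field K] [Field L] [Algebra K L] [FiniteDimensional K L]
  [Algebra.IsSeparable K L]

theorem isSmoothHypersurface_traceForm_refl {n : ℕ} (b : Module.Basis (Fin (n + 1)) K L) (e : ℕ)
    (he : ((e + 1 : ℕ) : K) ≠ 0) {a : L} (ha : a ≠ 0) :
    SmoothSystem.IsSmoothHypersurface (traceForm b (AlgEquiv.refl : L ≃ₐ[K] L) e a) := by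
  rintro v hv ⟨h0, h1⟩
  obtain ⟨y, hy, -, h⟩ := exists_of_singular_traceForm b _ e a v hv h0 h1
  refine hy (funext fun τ ↦ ?_)
  have hτ : precompEquiv (AlgebraicClosure K) (AlgEquiv.refl : L ≃ₐ[K] L) τ = τ := by
    ext; rfl
  have ha' : τ a ≠ 0 := (map_ne_zero τ).2 ha
  have he' : (e + 1 : AlgebraicClosure K) ≠ 0 := by
    intro h
    apply he
    apply (algebraMap K (AlgebraicClosure K)).injective
    simpa using h
  have h2 := h τ
  rw [hτ, hτ] at h2
  -- For `e = 0` the truncated exponent `e - 1` is harmless, its coefficient being zero.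
  rcases e with _ | e
  · simp [ha'] at h2
  · have : (((e + 1 : ℕ) : AlgebraicClosure K) + 1) * τ a * y τ ^ (e + 1) = 0 := by
      rw [← h2, Nat.add_sub_cancel]
      ring
    simpa [ha', -Nat.cast_add, he'] using this

omit [FiniteDimensional K L] [Algebra.IsSeparable K L] in
theorem precompEquiv_iterate (E : Type*) [Field E] [Algebra K E] (φ : L ≃ₐ[K] L) (i : ℕ)
    (τ : L →ₐ[K] E) : (precompEquiv E φ)^[i] τ = precompEquiv E (φ ^ i) τ := by
  induction i with
  | zero => ext; rfl
  | succ i ih => rw [Function.iterate_succ_apply', ih]; ext; simp [precompEquiv, pow_succ]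

omit [FiniteDimensional K L] [Algebra.IsSeparable K L] in
theorem precompEquiv_iterate_finrank (E : Type*) [Field E] [Algebra K E] {φ : L ≃ₐ[K] L}
    (hφ : orderOf φ = Module.finrank K L) (τ : L →ₐ[K] E) :
    (precompEquiv E φ)^[Module.finrank K L] τ = τ := by
  rw [precompEquiv_iterate, ← hφ, pow_orderOf_eq_one]
  ext; rfl

theorem exists_precompEquiv_iterate_eq {E : Type*} [Field E] [Algebra K E] [IsAlgClosed E]
    {φ : L ≃ₐ[K] L} (hφ : orderOf φ = Module.finrank K L) (τ τ' : L →ₐ[K] E) :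
    ∃ i, (precompEquiv E φ)^[i] τ = τ' := by
  have hinj : Function.Injective
      (fun i : Fin (Module.finrank K L) ↦ (precompEquiv E φ)^[(i : ℕ)] τ) := by
    intro i j hij
    simp only [precompEquiv_iterate] at hij
    have : φ ^ (i : ℕ) = φ ^ (j : ℕ) := by
      ext x
      exact τ.injective (DFunLike.congr_fun hij x)
    exact Fin.ext (pow_injOn_Iio_orderOf (by simp [hφ]) (by simp [hφ]) this)
  have hbij := (Fintype.bijective_iff_injective_and_card _).2
    ⟨hinj, by rw [Fintype.card_fin, AlgHom.card]⟩
  obtain ⟨i, hi⟩ := hbij.2 τ'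
  exact ⟨i, hi⟩

/-- At a singular point all terms of the Klein form coincide, because `e = -1` in `K`. Their sum is
zero and `n + 1` is invertible, so each term is zero; the gradient relations then propagate this
around the cycle to `y = 0`. -/
theorem isSmoothHypersurface_traceForm {n : ℕ} (b : Module.Basis (Fin (n + 1)) K L) {φ : L ≃ₐ[K] L}
    (hφ : orderOf φ = Module.finrank K L) (e : ℕ) (he : ((e + 1 : ℕ) : K) = 0)
    (hn : ((n + 1 : ℕ) : K) ≠ 0) {a : L} (ha : a ≠ 0) :
    SmoothSystem.IsSmoothHypersurface (traceForm b (φ : L →ₐ[K] L) e a) := by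
  rintro v hv ⟨h0, h1⟩
  obtain ⟨y, hy, hsum, h⟩ := exists_of_singular_traceForm b _ e a v hv h0 h1
  have hfr : Module.finrank K L = n + 1 := by simp [Module.finrank_eq_card_basis b]
  have htrans := exists_precompEquiv_iterate_eq (E := AlgebraicClosure K) hφ
  have hper := precompEquiv_iterate_finrank (AlgebraicClosure K) hφ
  rw [hfr] at hper
  set s := precompEquiv (AlgebraicClosure K) φ
  have ha' : ∀ τ : L →ₐ[K] AlgebraicClosure K, τ a ≠ 0 := fun τ ↦ (map_ne_zero τ).2 ha
  have he' : (e : AlgebraicClosure K) = -1 := by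
    rw [eq_neg_iff_add_eq_zero]
    simpa using congrArg (algebraMap K (AlgebraicClosure K)) he
  have hn' : ((n + 1 : ℕ) : AlgebraicClosure K) ≠ 0 := by
    intro h
    apply hn
    apply (algebraMap K (AlgebraicClosure K)).injective
    simpa using h
  obtain ⟨e, rfl⟩ : ∃ k, e = k + 1 := Nat.exists_eq_succ_of_ne_zero (by rintro rfl; simp at he)
  rw [he', Nat.add_sub_cancel] at h
  have hstep : ∀ τ, s τ a * (y (s τ) ^ (e + 1) * y (s (s τ))) = τ a * (y τ ^ (e + 1) * y (s τ)) := by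
    intro τ
    linear_combination -y (s τ) * h τ
  have hconst : ∀ τ τ' : L →ₐ[K] AlgebraicClosure K,
      τ' a * (y τ' ^ (e + 1) * y (s τ')) = τ a * (y τ ^ (e + 1) * y (s τ)) := by
    intro τ τ'
    obtain ⟨i, rfl⟩ := htrans τ τ'
    induction i with
    | zero => rfl
    | succ i ih => rw [Function.iterate_succ_apply', hstep, ih]
  have hzero : ∀ τ, y τ = 0 ∨ y (s τ) = 0 := by
    intro τ
    rw [Finset.sum_congr rfl fun τ' _ ↦ hconst τ τ', Finset.sum_const, Finset.card_univ,
      AlgHom.card, hfr, nsmul_eq_mul] at hsum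
    simpa [ha', -Nat.cast_add, hn'] using hsum
  obtain ⟨τ, hτ⟩ := Function.ne_iff.1 hy
  rw [Pi.zero_apply] at hτ
  -- Here `d = 2` and the characteristic is 2: nonvanishing moves two steps at a time, and since `n
  -- + 1` is odd it reaches `s τ`.
  rcases e with _ | e
  · have heven : ∀ i, y (s^[2 * i] τ) ≠ 0 := by
      intro i
      induction i with
      | zero => exact hτ
      | succ i ih =>
        intro h2
        rw [mul_add, mul_one, add_comm, Function.iterate_add_apply] at h2
        have := h (s^[2 * i] τ)
        simp only [Function.iterate_succ_apply, Function.iterate_zero, id] at h2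
        rw [h2] at this
        simp [ha', ih] at this
    have hodd : ¬ 2 ∣ n + 1 := by
      rintro ⟨k, hk⟩
      apply hn
      have : (2 : K) = 0 := by simpa [one_add_one_eq_two] using he
      rw [hk, Nat.cast_mul, Nat.cast_ofNat, this, zero_mul]
    obtain ⟨k, hk⟩ : ∃ k, n + 1 + 1 = 2 * k := ⟨(n + 2) / 2, by omega⟩
    have h3 := heven k
    rw [← hk, Function.iterate_succ_apply', hper] at h3
    exact (hzero τ).elim hτ h3
  -- For `d > 2` a single zero spreads backwards along the whole cycle.
  · have hback : ∀ τ, y (s τ) = 0 → y τ = 0 := by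
      intro τ h2
      have := h τ
      rw [h2] at this
      simpa [ha'] using this
    have hz : ∃ τ', y τ' = 0 := (hzero τ).elim (fun h ↦ ⟨_, h⟩) (fun h ↦ ⟨_, h⟩)
    obtain ⟨τ', hτ'⟩ := hz
    obtain ⟨i, rfl⟩ := htrans τ τ'
    refine hτ ?_
    clear hτ
    induction i with
    | zero => exact hτ'
    | succ i ih => exact ih (hback _ (by rwa [← Function.iterate_succ_apply' s]))

end Smooth

/-! ### From linear families to systems, and the dimension bound -/

section System

variable {K : Type*} [Field K]

theorem not_isSmoothHypersurface_zero (n : ℕ) :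
    ¬ SmoothSystem.IsSmoothHypersurface (0 : MvPolynomial (Fin (n + 1)) K) := fun h ↦
  h (fun _ ↦ 1) (fun h0 ↦ one_ne_zero (congrFun h0 0)) ⟨by simp, by simp⟩

/-- A linear family of smooth hypersurfaces indexed by a vector space of dimension `n + 1` contains
smooth systems of every dimension up to `n`. -/
theorem exists_system_of_linearMap {V : Type*} [AddCommGroup V] [Module K V] {n r d : ℕ}
    (b : Module.Basis (Fin (n + 1)) K V) (T : V →ₗ[K] MvPolynomial (Fin (n + 1)) K)
    (hT : ∀ a, (T a).IsHomogeneous d)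
    (hs : ∀ a, a ≠ 0 → SmoothSystem.IsSmoothHypersurface (T a)) (hr : r ≤ n) :
    ∃ F : Fin (r + 1) → MvPolynomial (Fin (n + 1)) K,
      (∀ i, (F i).IsHomogeneous d) ∧
      SmoothSystem.IsLinearSystem (Submodule.span K (Set.range F)) d r ∧
      SmoothSystem.IsKSmooth (Submodule.span K (Set.range F)) := by
  -- Injectivity is automatic: the zero form is singular everywhere.
  have hker : LinearMap.ker T = ⊥ := by
    refine LinearMap.ker_eq_bot'.2 fun a ha ↦ ?_
    by_contra h
    exact not_isSmoothHypersurface_zero n (ha ▸ hs a h)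
  have hli : LinearIndependent K fun i : Fin (r + 1) ↦ T (b (Fin.castLE (by omega) i)) :=
    (b.linearIndependent.comp _ (Fin.castLE_injective (by omega))).map' T hker
  refine ⟨_, fun i ↦ hT _, ⟨?_, by simpa using finrank_span_eq_card hli⟩, ?_⟩
  · rw [Submodule.span_le]
    rintro _ ⟨i, rfl⟩
    exact hT _
  · intro F hF hF0
    have : Submodule.span K (Set.range fun i : Fin (r + 1) ↦ T (b (Fin.castLE (by omega) i))) ≤
        LinearMap.range T := by
      rw [Submodule.span_le]
      rintro _ ⟨i, rfl⟩
      exact ⟨_, rfl⟩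
    obtain ⟨a, rfl⟩ := this hF
    exact hs a fun h ↦ hF0 (by rw [h, map_zero])

/-- A linear system of dimension greater than `n` has a member singular at `(1 : 0 : ⋯ : 0)`. -/
theorem not_isKSmooth_of_lt {n r d : ℕ} (hr : n + 1 ≤ r)
    (S : Submodule K (MvPolynomial (Fin (n + 1)) K)) (hS : SmoothSystem.IsLinearSystem S d r) :
    ¬ SmoothSystem.IsKSmooth S := by
  intro hsm
  let v : Fin (n + 1) → K := Pi.single 0 1
  -- The partial derivative in `x_0` is omitted, leaving `n + 1` conditions; at `v` Euler's identity
  -- reads `∂F/∂x_0 = d F`, which supplies it.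
  let φ : MvPolynomial (Fin (n + 1)) K →ₗ[K] (Fin (n + 1) → K) := LinearMap.pi <|
    Fin.cons (MvPolynomial.aeval v).toLinearMap fun i : Fin n ↦
      (MvPolynomial.aeval v).toLinearMap ∘ₗ (MvPolynomial.pderiv i.succ).toLinearMap
  have : FiniteDimensional K S := Module.finite_of_finrank_pos (by rw [hS.2]; omega)
  have hker := LinearMap.ker_ne_bot_of_finrank_lt (f := φ ∘ₗ S.subtype) (by
    rw [hS.2, Module.finrank_fin_fun]; omega)
  obtain ⟨⟨F, hF⟩, hφ, hF0⟩ := (Submodule.ne_bot_iff _).1 hker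
  have hφF : φ F = 0 := hφ
  have h0 : MvPolynomial.aeval v F = 0 := congrFun hφF 0
  have h1 : ∀ i, MvPolynomial.aeval v (MvPolynomial.pderiv i F) = 0 := by
    intro i
    induction i using Fin.cases with
    | succ i => exact congrFun hφF i.succ
    | zero =>
      have hE := congrArg (MvPolynomial.aeval v) (MvPolynomial.IsHomogeneous.sum_X_mul_pderiv
        ((MvPolynomial.mem_homogeneousSubmodule _ _).1 (hS.1 hF)))
      have h0' : MvPolynomial.eval v F = 0 := by simpa using h0
      rw [map_sum] at hE
      simpa [h0', v, Pi.single_apply] using hE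
  refine hsm F hF (fun h ↦ hF0 (Subtype.ext h)) (algebraMap K (AlgebraicClosure K) ∘ v)
    (fun h ↦ ?_) ⟨?_, fun i ↦ ?_⟩
  · simpa [v] using congrFun h 0
  · exact (MvPolynomial.aeval_algebraMap_apply (AlgebraicClosure K) v F).trans (by rw [h0, map_zero])
  · exact (MvPolynomial.aeval_algebraMap_apply (AlgebraicClosure K) v _).trans
      (by rw [h1, map_zero])

end System

/-! ### Relative algebraic closure in a finitely generated field -/

section Closure

open scoped IntermediateField.algebraAdjoinAdjoin

/-- A linearly independent family of algebraic elements stays linearly independent over the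
subalgebra generated by algebraically independent elements. -/
theorem linearIndependent_adjoin_of_algebraicIndependent {F E ι σ : Type*} [Field F] [Field E]
    [Algebra F E] {x : σ → E} (hx : AlgebraicIndependent F x) {w : ι → algebraicClosure F E}
    (hw : LinearIndependent F w) :
    LinearIndependent (Algebra.adjoin F (Set.range x)) fun i ↦ (w i : E) := by
  have hx' : AlgebraicIndependent (algebraicClosure F E) x := hx.algebraicClosure
  rw [linearIndependent_iff']
  intro s g hg
  let p : ι → MvPolynomial σ F := fun i ↦ hx.aevalEquiv.symm (g i)
  have hp : ∀ i, (g i : E) = MvPolynomial.aeval x (p i) := by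
    intro i
    rw [← hx.algebraMap_aevalEquiv, AlgEquiv.apply_symm_apply]
    rfl
  have hP : ∑ i ∈ s, MvPolynomial.C (w i) *
      MvPolynomial.map (algebraMap F (algebraicClosure F E)) (p i) = 0 := by
    rw [algebraicIndependent_iff] at hx'
    apply hx'
    rw [← hg, map_sum]
    refine Finset.sum_congr rfl fun i _ ↦ ?_
    rw [map_mul, MvPolynomial.aeval_map_algebraMap, MvPolynomial.aeval_C, ← hp, mul_comm]
    rfl
  intro i hi
  -- `x` stays independent over the algebraic closure, so the relation can be compared
  -- coefficientwise.
  have : p i = 0 := by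
    ext m
    have hm := congrArg (MvPolynomial.coeff m) hP
    simp only [MvPolynomial.coeff_sum, MvPolynomial.coeff_C_mul, MvPolynomial.coeff_map,
      MvPolynomial.coeff_zero] at hm
    refine linearIndependent_iff'.1 hw s (fun i ↦ MvPolynomial.coeff m (p i)) ?_ i hi
    rw [← hm]
    refine Finset.sum_congr rfl fun i _ ↦ ?_
    rw [Algebra.smul_def, mul_comm]
  exact hx.aevalEquiv.symm.map_eq_zero_iff.1 this

/-- The relative algebraic closure in a finitely generated extension is finite. -/
theorem finite_algebraicClosure_of_essFiniteType (F E : Type*) [Field F] [Field E] [Algebra F E]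
    [Algebra.EssFiniteType F E] : Module.Finite F (algebraicClosure F E) := by
  obtain ⟨s, hs⟩ := exists_finset_isTranscendenceBasis F E
  have hr : Set.range ((↑) : s → E) = s := Subtype.range_coe
  have halg : Algebra.IsAlgebraic (IntermediateField.adjoin F (s : Set E)) E := by
    have := hs.isAlgebraic_field
    rwa [hr] at this
  have : Algebra.EssFiniteType (IntermediateField.adjoin F (s : Set E)) E :=
    Algebra.EssFiniteType.of_comp F _ E
  have hfin : Module.Finite (IntermediateField.adjoin F (s : Set E)) E :=
    Algebra.finite_of_essFiniteType_of_isAlgebraic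
  -- A basis over `F` stays independent over `F(s)`, over which `E` is finite.
  let b := Module.Basis.ofVectorSpace F (algebraicClosure F E)
  have hli := linearIndependent_adjoin_of_algebraicIndependent hs.1 b.linearIndependent
  rw [hr] at hli
  have hli' := (LinearIndependent.iff_fractionRing (Algebra.adjoin F (s : Set E))
    (IntermediateField.adjoin F (s : Set E))).1 hli
  have := hli'.finite
  exact Module.Finite.of_basis b

/-- An irreducible polynomial over a relatively algebraically closed subfield stays irreducible. -/
theorem irreducible_map_of_algebraicClosure {F E : Type*} [Field F] [Field E] [Algebra F E]
    {f : Polynomial (algebraicClosure F E)} (hm : f.Monic) (hf : Irreducible f) :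
    Irreducible (f.map (algebraMap (algebraicClosure F E) E)) := by
  -- Coefficients of a monic factor are integral over the closure, hence algebraic over `F`, hence
  -- in it.
  have hlift : ∀ p : Polynomial E, p.Monic →
      p ∣ f.map (algebraMap (algebraicClosure F E) E) →
      ∃ p' : Polynomial (algebraicClosure F E), p'.map (algebraMap (algebraicClosure F E) E) = p := by
    intro p hp hdvd
    have h := integralClosure.mem_lifts_of_monic_of_dvd_map E hm hp hdvd
    rw [Polynomial.lifts_iff_coeff_lifts] at h
    refine (Polynomial.mem_lifts _).1 ((Polynomial.lifts_iff_coeff_lifts _).2 fun i ↦ ?_)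
    obtain ⟨⟨c, hc⟩, hc'⟩ := h i
    have hc2 : IsAlgebraic (algebraicClosure F E) c := IsIntegral.isAlgebraic hc
    exact ⟨⟨c, mem_algebraicClosure_iff.2 (hc2.restrictScalars F)⟩, hc'⟩
  have hu : ∀ p : Polynomial (algebraicClosure F E), IsUnit p →
      (p.map (algebraMap (algebraicClosure F E) E)).Monic →
      p.map (algebraMap (algebraicClosure F E) E) = 1 := fun p hp hm ↦
    hm.eq_one_of_isUnit (hp.map (Polynomial.mapRingHom _))
  have hinj := Polynomial.map_injective _ (algebraMap (algebraicClosure F E) E).injective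
  rw [Polynomial.irreducible_of_monic (hm.map _)
    fun h ↦ hf.ne_one (hinj (by rw [h, Polynomial.map_one]))]
  intro p q hp hq hpq
  obtain ⟨p, rfl⟩ := hlift p hp (Dvd.intro _ hpq)
  obtain ⟨q, rfl⟩ := hlift q hq (Dvd.intro_left _ hpq)
  rw [← Polynomial.map_mul] at hpq
  exact (hf.isUnit_or_isUnit (hinj hpq).symm).imp (hu p · hp) (hu q · hq)

end Closure

/-! ### Separable and cyclic extensions of prescribed degree -/

section Extensions

universe u

open Polynomial

theorem essFiniteType_of_isFinitelyGeneratedField (F : Type*) {K : Type*} [Field F] [Field K]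
    [Algebra F K] (h : SmoothSystem.IsFinitelyGeneratedField K) : Algebra.EssFiniteType F K := by
  obtain ⟨s, hs⟩ := h
  rw [← IntermediateField.fg_top_iff]
  refine ⟨s, ?_⟩
  rw [eq_top_iff]
  intro x _
  have hle : Subfield.closure (s : Set K) ≤ (IntermediateField.adjoin F (s : Set K)).toSubfield :=
    Subfield.closure_le.2 (IntermediateField.subset_adjoin F _)
  exact hle (hs ▸ Subfield.mem_top x)

/-- Over a number field there are Eisenstein polynomials of every positive degree. -/
theorem exists_monic_irreducible_of_numberField (k : Type*) [Field k] [NumberField k] {m : ℕ}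
    (hm : 0 < m) : ∃ f : k[X], f.Monic ∧ Irreducible f ∧ f.natDegree = m := by
  obtain ⟨P, hP⟩ := Ideal.exists_maximal (NumberField.RingOfIntegers k)
  have hbot : P ≠ ⊥ :=
    (Ideal.bot_lt_of_maximal P (NumberField.RingOfIntegers.not_isField k)).ne'
  obtain ⟨π, hπ, hπ2⟩ := Ideal.exists_mem_pow_notMem_pow_succ P hbot hP.ne_top 1
  rw [pow_one] at hπ
  have hmon : (X ^ m - C π).Monic := monic_X_pow_sub_C π hm.ne'
  have hdeg : (X ^ m - C π).natDegree = m := natDegree_X_pow_sub_C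
  have heis : (X ^ m - C π).IsEisensteinAt P := by
    refine hmon.isEisensteinAt_of_mem_of_notMem hP.ne_top (fun {i} hi ↦ ?_) ?_
    · rw [hdeg] at hi
      rw [coeff_sub, coeff_X_pow, if_neg hi.ne, coeff_C, zero_sub]
      split_ifs <;> simp [hπ]
    · simpa [coeff_X_pow, hm.ne, hm.ne'] using hπ2
  have hirr := heis.irreducible hP.isPrime hmon.isPrimitive (by rwa [hdeg])
  refine ⟨(X ^ m - C π).map (algebraMap _ k), hmon.map _,
    (hmon.irreducible_iff_irreducible_map_fraction_map).1 hirr, ?_⟩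
  rw [hmon.natDegree_map, hdeg]

theorem exists_monic_irreducible_of_finite (k : Type*) [Field k] [Finite k] {m : ℕ}
    (hm : 0 < m) : ∃ f : k[X], f.Monic ∧ Irreducible f ∧ f.natDegree = m := by
  obtain ⟨p, hp⟩ := CharP.exists k
  have : Fact p.Prime := ⟨CharP.char_is_prime k p⟩
  have : NeZero m := ⟨hm.ne'⟩
  obtain ⟨x, hx⟩ := Field.exists_primitive_element k (FiniteField.Extension k p m)
  have hint : IsIntegral k x := .of_finite k x
  refine ⟨minpoly k x, minpoly.monic hint, minpoly.irreducible hint, ?_⟩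
  rw [← IntermediateField.adjoin.finrank hint, hx, IntermediateField.finrank_top',
    FiniteField.finrank_extension]

theorem exists_separable_extension_of_charZero (K : Type u) [Field K] [CharZero K]
    (hK : SmoothSystem.IsFinitelyGeneratedField K) {m : ℕ} (hm : 0 < m) :
    ∃ (L : Type u) (_ : Field L) (_ : Algebra K L), FiniteDimensional K L ∧
      Algebra.IsSeparable K L ∧ Module.finrank K L = m := by
  have := essFiniteType_of_isFinitelyGeneratedField ℚ hK
  have : FiniteDimensional ℚ (algebraicClosure ℚ K) := finite_algebraicClosure_of_essFiniteType ℚ K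
  have : NumberField (algebraicClosure ℚ K) :=
    { to_charZero := inferInstance, to_finiteDimensional := by convert this }
  obtain ⟨f, hf, hirr, hdeg⟩ := exists_monic_irreducible_of_numberField (algebraicClosure ℚ K) hm
  have hfact := Fact.mk (irreducible_map_of_algebraicClosure hf hirr)
  have hmon := hf.map (algebraMap (algebraicClosure ℚ K) K)
  have := (AdjoinRoot.powerBasis hmon.ne_zero).finite
  refine ⟨AdjoinRoot (f.map (algebraMap (algebraicClosure ℚ K) K)), inferInstance, inferInstance,
    this, inferInstance, ?_⟩
  rw [(AdjoinRoot.powerBasis hmon.ne_zero).finrank, AdjoinRoot.powerBasis_dim, hf.natDegree_map,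
    hdeg]

theorem exists_cyclic_extension_of_charP (K : Type u) [Field K] (p : ℕ) [Fact p.Prime] [CharP K p]
    (hK : SmoothSystem.IsFinitelyGeneratedField K) {m : ℕ} (hm : 0 < m) :
    ∃ (L : Type u) (_ : Field L) (_ : Algebra K L), FiniteDimensional K L ∧
      Algebra.IsSeparable K L ∧ Module.finrank K L = m ∧ ∃ φ : L ≃ₐ[K] L, orderOf φ = m := by
  let := ZMod.algebra K p
  have := essFiniteType_of_isFinitelyGeneratedField (ZMod p) hK
  have := finite_algebraicClosure_of_essFiniteType (ZMod p) K
  let k := algebraicClosure (ZMod p) K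
  have : Finite k := Module.finite_of_finite (ZMod p)
  let := Fintype.ofFinite k
  obtain ⟨f, hf, hirr, hdeg⟩ := exists_monic_irreducible_of_finite k hm
  let g := f.map (algebraMap k K)
  have hfact : Fact (Irreducible g) := Fact.mk (irreducible_map_of_algebraicClosure hf hirr)
  have hmon : g.Monic := hf.map (algebraMap k K)
  have hfin := (AdjoinRoot.powerBasis hmon.ne_zero).finite
  have hrank : Module.finrank K (AdjoinRoot g) = m := by
    rw [(AdjoinRoot.powerBasis hmon.ne_zero).finrank, AdjoinRoot.powerBasis_dim, hf.natDegree_map,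
      hdeg]
  let F := FiniteField.frobeniusAlgHom k (AdjoinRoot g)
  have hroot : aeval (AdjoinRoot.root g) f = 0 := by
    rw [← aeval_map_algebraMap K, AdjoinRoot.aeval_eq, AdjoinRoot.mk_self]
  have hFroot : aeval (F (AdjoinRoot.root g)) g = 0 := by
    rw [aeval_map_algebraMap, aeval_algHom_apply, hroot, map_zero]
  -- Frobenius is only `k`-linear; `ψ` is the `K`-linear map agreeing with it on the root.
  let ψ : AdjoinRoot g →ₐ[K] AdjoinRoot g :=
    AdjoinRoot.liftAlgHom g (Algebra.ofId K _) (F (AdjoinRoot.root g)) hFroot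
  have hψ : ψ (AdjoinRoot.root g) = AdjoinRoot.root g ^ Fintype.card k := by
    simp [ψ, F]
  let φ := AlgEquiv.ofBijective ψ (Algebra.IsAlgebraic.algHom_bijective ψ)
  have hφ : φ (AdjoinRoot.root g) = AdjoinRoot.root g ^ Nat.card k := by
    rw [Nat.card_eq_fintype_card]; exact hψ
  have hpow : ∀ i : ℕ, (φ ^ i) (AdjoinRoot.root g) = AdjoinRoot.root g ^ Nat.card k ^ i := by
    intro i
    induction i with
    | zero => simp
    | succ i ih => rw [pow_succ, AlgEquiv.mul_apply, hφ, map_pow, ih, ← pow_mul, ← pow_succ]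
  -- With `q = #k`, `φ ^ i` fixes the root iff `f ∣ X ^ (q ^ i) - X`, that is, iff `deg f ∣ i`.
  have hmp : ∀ i : ℕ, φ ^ i = 1 ↔ m ∣ i := by
    intro i
    rw [← hdeg, hirr.natDegree_dvd_iff_dvd_X_pow_card_pow_sub_X,
      ← hirr.dvd_iff_aeval_eq_zero hroot, map_sub, map_pow, aeval_X, sub_eq_zero, ← hpow]
    refine ⟨fun h ↦ by rw [h, AlgEquiv.one_apply], fun h ↦ ?_⟩
    have : ((φ ^ i : AdjoinRoot g ≃ₐ[K] AdjoinRoot g) : AdjoinRoot g →ₐ[K] AdjoinRoot g) =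
        AlgHom.id K _ := AdjoinRoot.algHom_ext h
    exact AlgEquiv.ext fun x ↦ DFunLike.congr_fun this x
  have hord : orderOf φ = m := by
    refine Nat.dvd_antisymm (orderOf_dvd_of_pow_eq_one ((hmp m).2 dvd_rfl)) ?_
    exact (hmp _).1 (pow_orderOf_eq_one φ)
  -- The `m` powers of `φ` already exhaust the degree; separability follows.
  have hgal : IsGalois K (AdjoinRoot g) := by
    refine IsGalois.of_card_aut_eq_finrank K _ (le_antisymm ?_ ?_)
    · rw [Nat.card_eq_fintype_card]
      exact AlgEquiv.card_le
    · rw [hrank, ← hord]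
      exact orderOf_le_card
  exact ⟨AdjoinRoot g, inferInstance, inferInstance, hfin, inferInstance, hrank, φ, hord⟩

end Extensions

theorem theorem1p1 (K : Type*) [Field K] (n r : ℕ) :
    (n + 1 ≤ r → ∀ d : ℕ, 2 ≤ d →
      ¬ ∃ S : Submodule K (MvPolynomial (Fin (n + 1)) K),
        SmoothSystem.IsLinearSystem S d r ∧ SmoothSystem.IsKSmooth S) ∧
    (∀ p : ℕ, CharP K p → SmoothSystem.IsFinitelyGeneratedField K →
      ∀ d : ℕ, 1 ≤ d → r ≤ n → ¬ p ∣ Nat.gcd d (n + 1) →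
        ∃ F : Fin (r + 1) → MvPolynomial (Fin (n + 1)) K,
          (∀ i, (F i).IsHomogeneous d) ∧
          SmoothSystem.IsLinearSystem (Submodule.span K (Set.range F)) d r ∧
          SmoothSystem.IsKSmooth (Submodule.span K (Set.range F))) := by
  refine ⟨fun hr d _ ⟨S, hS, hsm⟩ ↦ not_isKSmooth_of_lt hr S hS hsm, ?_⟩
  intro p _ hK d hd hr hp
  obtain ⟨e, rfl⟩ : ∃ e, d = e + 1 := ⟨d - 1, by omega⟩
  rcases CharP.char_is_prime_or_zero K p with hprime | rfl
  · have := Fact.mk hprime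
    obtain ⟨L, _, _, _, _, hfr, φ, hφ⟩ := exists_cyclic_extension_of_charP K p hK n.succ_pos
    let b := Module.finBasisOfFinrankEq K L hfr
    by_cases he : ((e + 1 : ℕ) : K) = 0
    · have hn : ((n + 1 : ℕ) : K) ≠ 0 := fun h ↦
        hp (Nat.dvd_gcd ((CharP.cast_eq_zero_iff K p _).1 he) ((CharP.cast_eq_zero_iff K p _).1 h))
      exact exists_system_of_linearMap b _ (isHomogeneous_traceForm b _ e)
        (fun a ↦ isSmoothHypersurface_traceForm b (hφ.trans hfr.symm) e he hn) hr
    · exact exists_system_of_linearMap b _ (isHomogeneous_traceForm b _ e)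
        (fun a ↦ isSmoothHypersurface_traceForm_refl b e he) hr
  · have := CharP.charP_to_charZero K
    obtain ⟨L, _, _, _, _, hfr⟩ := exists_separable_extension_of_charZero K hK n.succ_pos
    let b := Module.finBasisOfFinrankEq K L hfr
    exact exists_system_of_linearMap b _ (isHomogeneous_traceForm b _ e)
      (fun a ↦ isSmoothHypersurface_traceForm_refl b e (by exact_mod_cast e.succ_ne_zero)) hr
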